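/- Let $\lambda\in\mathbb C$ and suppose that the plane cubic $F(x,y,z)=yz^2-x(x-y)(x-\lambda y)$ over $\mathbb C$ is smooth. A *pfaffian representation* of $F$ is a $6\times 6$ skew-symmetric matrix $A=xA_x+yA_y+zA_z$ with $A_x,A_y,A_z\in M_6(\mathbb C)$ and $\det A=cF^2$ for some $c\in\mathbb C\setminus\{0\}$. Two of them are *equivalent* if they are related by $A\mapsto PAP^t$ with $P\in GL_6(\mathbb C)$. A pfaffian representation is *decomposable* if it is equivalent to $\begin{pmatrix}0&B\\-B^t&0\end{pmatrix}$ for some $3\times3$ matrix $B=xB_x+yB_y+zB_z$ with $\det B=c'F$, $c'\ne0$, and *indecomposable* otherwise. For $t,s,\epsilon\in\mathbb C$ let $M_\epsilon(t,s)$ be the skew-symmetric matrix (only the upper triangle is written) $$x\begin{bmatrix}0&0&0&0&0&1\\&0&0&0&1&0\\&&0&1&0&0\\&&&0&0&0\\&&&&0&0\\&&&&&0\end{bmatrix}+z\begin{bmatrix}0&0&0&0&1&0\\&0&0&1&0&0\\&&0&0&0&0\\&&&0&0&0\\&&&&0&0\\&&&&&0\end{bmatrix}+y\begin{bmatrix}0&\epsilon&0&\frac{3t^2-2t(1+\lambda)-(1-\lambda)^2}{4}&s&\frac{t-1-\lambda}{2}\\&0&0&-s&-t&0\\&&0&\frac{t-1-\lambda}{2}&0&-1\\&&&0&0&0\\&&&&0&0\\&&&&&0\end{bmatrix}.$$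 (1) For all $t,s\in\mathbb C$ with $s^2=t(t-1)(t-\lambda)$, the matrix $M_0(t,s)$ is a decomposable pfaffian representation of $F$. (2) For each $t\in\{0,1,\lambda\}$, the matrix $M_1(t,0)$ is an indecomposable pfaffian representation of $F$; moreover no $XM_1(t,0)Y$ with $X,Y\in GL_6(\mathbb C)$ is, after a simultaneous permutation of rows and columns, block diagonal with two square blocks of positive size. (3) Every decomposable pfaffian representation of $F$ is equivalent to $M_0(t,s)$ for some $t,s\in\mathbb C$ with $s^2=t(t-1)(t-\lambda)$, and every indecomposable one is equivalent to $M_1(t,0)$ for exactly one $t\in\{0,1,\lambda\}$. (4) The numbers $0,1,\lambda$ are distinct and $M_1(0,0)$, $M_1(1,0)$, $M_1(\lambda,0)$ are pairwise inequivalent, so there are exactly three equivalence classes of indecomposable pfaffian representations. If $s^2=t(t-1)(t-\lambda)$ and $s'^2=t'(t'-1)(t'-\lambda)$, then $M_0(t,s)$ and $M_0(t',s')$ are equivalent if and only if $t=t'$ and $s'=\pm s$. -/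

import Mathlib

open MvPolynomial Matrix

noncomputable section

/-- A square matrix of linear forms in `x, y, z` over `ℂ`, given by its coefficient matrices:
`A 0`, `A 1`, `A 2` are the coefficients of `x`, `y`, `z` respectively. -/
abbrev LinearMatrix (n : ℕ) : Type := Fin 3 → Matrix (Fin n) (Fin n) ℂ

namespace LinearMatrix

variable {n : ℕ}

/-- The matrix of polynomials `x A_x + y A_y + z A_z`. -/
def toPoly (A : LinearMatrix n) : Matrix (Fin n) (Fin n) (MvPolynomial (Fin 3) ℂ) :=
  ∑ k : Fin 3, (X k : MvPolynomial (Fin 3) ℂ) • (A k).map (C : ℂ →+* MvPolynomial (Fin 3) ℂ)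

/-- `A` is a determinantal representation of order `r` of the curve `F = 0`:
`det A = c F ^ r` for a nonzero constant `c`. -/
def IsDeterminantalRep (F : MvPolynomial (Fin 3) ℂ) (r : ℕ) (A : LinearMatrix n) : Prop :=
  ∃ c : ℂ, c ≠ 0 ∧ A.toPoly.det = C c * F ^ r

/-- A pfaffian representation of a plane cubic `F`: a `6 × 6` skew-symmetric
determinantal representation of order `2`. -/
def IsPfaffianRep (F : MvPolynomial (Fin 3) ℂ) (A : LinearMatrix 6) : Prop :=
  (∀ k, (A k)ᵀ = -A k) ∧ IsDeterminantalRep F 2 A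

/-- Equivalence of determinantal representations: `B = X A Y` with `X`, `Y` invertible. -/
def DetEquiv (A B : LinearMatrix n) : Prop :=
  ∃ X Y : GL (Fin n) ℂ, ∀ k,
    B k = (X : Matrix (Fin n) (Fin n) ℂ) * A k * (Y : Matrix (Fin n) (Fin n) ℂ)

/-- Equivalence of skew-symmetric representations: `B = P A Pᵗ` with `P` invertible. -/
def PfaffEquiv (A B : LinearMatrix n) : Prop :=
  ∃ P : GL (Fin n) ℂ, ∀ k,
    B k = (P : Matrix (Fin n) (Fin n) ℂ) * A k * (P : Matrix (Fin n) (Fin n) ℂ)ᵀ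

/-- The skew-symmetric block matrix `[0, B; -Bᵗ, 0]`. -/
def skewBlock (B : LinearMatrix 3) : LinearMatrix 6 := fun k =>
  Matrix.reindex (finSumFinEquiv (m := 3) (n := 3)) (finSumFinEquiv (m := 3) (n := 3))
    (Matrix.fromBlocks 0 (B k) (-(B k)ᵀ) 0)

/-- A decomposable pfaffian representation of the cubic `F`: one that is equivalent, under
`A ↦ P A Pᵗ`, to the one induced by a `3 × 3` determinantal representation of `F`. -/
def IsDecomposablePfaffian (F : MvPolynomial (Fin 3) ℂ) (A : LinearMatrix 6) : Prop :=
  ∃ B : LinearMatrix 3, IsDeterminantalRep F 1 B ∧ PfaffEquiv A (skewBlock B)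

/-- `A` is indecomposable as a determinantal representation: no `X A Y` with `X`, `Y`
invertible is block diagonal with two square blocks of positive size. -/
def IsIndecomposable (A : LinearMatrix n) : Prop :=
  ¬ ∃ (p q : ℕ) (e : Fin p ⊕ Fin q ≃ Fin n) (A₁ : LinearMatrix p) (A₂ : LinearMatrix q),
    0 < p ∧ 0 < q ∧
      DetEquiv A (fun k => Matrix.reindex e e (Matrix.fromBlocks (A₁ k) 0 0 (A₂ k)))

end LinearMatrix

/-- The curve `F = 0` in the complex projective plane is smooth: at no point of it do all
the partial derivatives of `F` vanish. -/
def IsSmoothCurve (F : MvPolynomial (Fin 3) ℂ) : Prop :=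
  ∀ v : Fin 3 → ℂ, v ≠ 0 → eval v F = 0 → ∃ i : Fin 3, eval v (pderiv i F) ≠ 0

/-- The Weierstrass cubic `y z² - x (x - y) (x - l y)`, with `x, y, z = X 0, X 1, X 2`. -/
def weierstrassCubic (l : ℂ) : MvPolynomial (Fin 3) ℂ :=
  X 1 * X 2 ^ 2 - X 0 * (X 0 - X 1) * (X 0 - C l * X 1)

/-- The skew-symmetric matrix with the given strictly upper triangular part. -/
def skewOfUpper (U : Matrix (Fin 6) (Fin 6) ℂ) : Matrix (Fin 6) (Fin 6) ℂ := U - Uᵀ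

/-- The coefficient of `x` in all the canonical representations. -/
def canonicalX : Matrix (Fin 6) (Fin 6) ℂ := skewOfUpper
  !![0, 0, 0, 0, 0, 1;
     0, 0, 0, 0, 1, 0;
     0, 0, 0, 1, 0, 0;
     0, 0, 0, 0, 0, 0;
     0, 0, 0, 0, 0, 0;
     0, 0, 0, 0, 0, 0]

/-- The coefficient of `z` in all the canonical representations. -/
def canonicalZ : Matrix (Fin 6) (Fin 6) ℂ := skewOfUpper
  !![0, 0, 0, 0, 1, 0;
     0, 0, 0, 1, 0, 0;
     0, 0, 0, 0, 0, 0;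
     0, 0, 0, 0, 0, 0;
     0, 0, 0, 0, 0, 0;
     0, 0, 0, 0, 0, 0]

/-- The decomposable representation attached to the point `(t, s)`. -/
def decomposableRep (l t s : ℂ) : LinearMatrix 6 :=
  ![canonicalX,
    skewOfUpper
      !![0, 0, 0, (3 * t ^ 2 - 2 * t * (1 + l) - (1 - l) ^ 2) / 4, s, (t - 1 - l) / 2;
         0, 0, 0, -s, -t, 0;
         0, 0, 0, (t - 1 - l) / 2, 0, -1;
         0, 0, 0, 0, 0, 0;
         0, 0, 0, 0, 0, 0;
         0, 0, 0, 0, 0, 0],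
    canonicalZ]

/-- The indecomposable representation attached to `t`. -/
def indecomposableRep (l t : ℂ) : LinearMatrix 6 :=
  ![canonicalX,
    skewOfUpper
      !![0, 1, 0, (3 * t ^ 2 - 2 * t * (1 + l) - (1 - l) ^ 2) / 4, 0, (t - 1 - l) / 2;
         0, 0, 0, 0, -t, 0;
         0, 0, 0, (t - 1 - l) / 2, 0, -1;
         0, 0, 0, 0, 0, 0;
         0, 0, 0, 0, 0, 0;
         0, 0, 0, 0, 0, 0],
    canonicalZ]

end

/-!
Restricted to the line `y = 0` a pfaffian representation is a pencil `x J + z J N` with `J` and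
`J N` skew-symmetric, so `N` is self-adjoint for the symplectic form `J`. The cubic is `-x ^ 3` on
this line, so `N` is nilpotent. The Jordan chain of any vector is isotropic, hence `N ^ 3 = 0`
(`pow_three_eq_zero`); and `N ^ 2 = 0` would force the determinant to vanish to order three at the
smooth point `(0 : 0 : 1)` (`sq_ne_zero_of_det`). A pair of dual Jordan chains then brings the
coefficients of `x` and `z` to their canonical form (`exists_dual_chains`). In other words, the
space is the free module of rank two over `R = ℂ[ε] / ε ^ 3` with its standard symplectic form, and
what is left of the group is `SL₂(R)`.

The coefficient of `y` is a `3 × 3` matrix of `2 × 2` blocks, hermitian for the involution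
`g ↦ adj g`, and the pfaffian is its cubic norm. Because the determinant is the square of the
pfaffian (`det_eq_pfaffianSix_sq`), the pfaffian is minus the cubic, and its coefficient of
`y z ^ 2` makes one diagonal block invertible. The part of `SL₂(R)` congruent to the identity
modulo `ε` therefore clears two off-diagonal blocks up to scalars (`exists_shear`,
`exists_second_shear`), and comparing coefficients determines everything except a number `t` and a
traceless matrix `K` with `-det K = t (t - 1) (t - l)` (`eq_normalRep`). The remaining `SL₂(ℂ)` acts
on `K` by conjugation, and the Jordan normal form of `K` gives the list: `K` is diagonal with
eigenvalues `s` and `-s`, or nilpotent and nonzero, the latter only for `t` in `{0, 1, l}`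
(`normalRep_pfaffEquiv_canonical`).

Conversely every intertwiner of two such normal forms, under multiplication by independent matrices
on the two sides, is a `2 × 2` matrix `g` with `g K = K' g`, and vanishes unless the numbers `t`
agree (`intertwiner_normalRep`). This separates the equivalence classes. It also shows that the
endomorphisms of an indecomposable normal form commute with a nonzero nilpotent matrix, so that
their only idempotents are `0` and `1`, while a block decomposition would provide another one
(`isIndecomposable_of_idempotent`). A decomposable pfaffian representation has such a block
decomposition, by swapping the two block columns.
-/

noncomputable section

/-! ### The pfaffian of a skew-symmetric matrix of size six -/

/-- The pfaffian of a skew-symmetric `6 × 6` matrix, expanded along the first row. It reads only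
the entries above the diagonal. -/
def pfaffianSix {R : Type*} [CommRing R] (A : Matrix (Fin 6) (Fin 6) R) : R :=
  A 0 1 * (A 2 3 * A 4 5 - A 2 4 * A 3 5 + A 2 5 * A 3 4)
    - A 0 2 * (A 1 3 * A 4 5 - A 1 4 * A 3 5 + A 1 5 * A 3 4)
    + A 0 3 * (A 1 2 * A 4 5 - A 1 4 * A 2 5 + A 1 5 * A 2 4)
    - A 0 4 * (A 1 2 * A 3 5 - A 1 3 * A 2 5 + A 1 5 * A 2 3)
    + A 0 5 * (A 1 2 * A 3 4 - A 1 3 * A 2 4 + A 1 4 * A 2 3)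

set_option maxHeartbeats 4000000 in
theorem det_eq_pfaffianSix_sq {R : Type*} [CommRing R] (A : Matrix (Fin 6) (Fin 6) R)
    (h0 : ∀ i, A i i = 0) (h : ∀ i j, A j i = -A i j) : A.det = pfaffianSix A ^ 2 := by
  have hA : A = !![0, A 0 1, A 0 2, A 0 3, A 0 4, A 0 5;
      -A 0 1, 0, A 1 2, A 1 3, A 1 4, A 1 5;
      -A 0 2, -A 1 2, 0, A 2 3, A 2 4, A 2 5;
      -A 0 3, -A 1 3, -A 2 3, 0, A 3 4, A 3 5;
      -A 0 4, -A 1 4, -A 2 4, -A 3 4, 0, A 4 5;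
      -A 0 5, -A 1 5, -A 2 5, -A 3 5, -A 4 5, 0] := by
    ext i j
    fin_cases i <;> fin_cases j <;> first | exact h0 _ | rfl | exact h _ _
  unfold pfaffianSix
  -- The entries become free variables, so that the sparse expansion below is a ring identity.
  generalize A 0 1 = a at *
  generalize A 0 2 = b at *
  generalize A 0 3 = c at *
  generalize A 0 4 = d at *
  generalize A 0 5 = e at *
  generalize A 1 2 = f at *
  generalize A 1 3 = g at *
  generalize A 1 4 = k at *
  generalize A 1 5 = l at *
  generalize A 2 3 = m at *
  generalize A 2 4 = n at *
  generalize A 2 5 = o at *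
  generalize A 3 4 = p at *
  generalize A 3 5 = q at *
  generalize A 4 5 = r at *
  clear h0 h
  rw [hA]
  clear hA
  simp [Matrix.det_succ_row_zero, Fin.sum_univ_succ, Fin.succAbove]
  ring

namespace LinearMatrix

variable {n : ℕ}

/-! ### Determinantal representations through their values -/

theorem toPoly_apply (A : LinearMatrix n) (i j : Fin n) :
    A.toPoly i j = ∑ k, X k * C (A k i j) := by
  simp [toPoly, Matrix.sum_apply]

theorem eval_det_toPoly (A : LinearMatrix n) (v : Fin 3 → ℂ) :
    eval v A.toPoly.det = (∑ k, v k • A k).det := by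
  rw [RingHom.map_det]
  congr 1
  ext i j
  simp [toPoly_apply, Matrix.sum_apply]

theorem isDeterminantalRep_iff (F : MvPolynomial (Fin 3) ℂ) (r : ℕ) (A : LinearMatrix n) :
    IsDeterminantalRep F r A ↔
      ∃ c : ℂ, c ≠ 0 ∧ ∀ v : Fin 3 → ℂ, (∑ k, v k • A k).det = c * eval v F ^ r := by
  refine exists_congr fun c => and_congr_right fun _ => ?_
  constructor
  · intro h v
    rw [← eval_det_toPoly, h]
    simp
  · intro h
    refine MvPolynomial.funext fun v => ?_
    rw [eval_det_toPoly, h]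
    simp

/-! ### Equivalence of representations -/

theorem PfaffEquiv.refl (A : LinearMatrix n) : PfaffEquiv A A := ⟨1, by simp⟩

theorem PfaffEquiv.symm {A B : LinearMatrix n} (h : PfaffEquiv A B) : PfaffEquiv B A := by
  obtain ⟨P, hP⟩ := h
  refine ⟨P⁻¹, fun k => ?_⟩
  have h1 : ((P⁻¹ : GL (Fin n) ℂ) : Matrix (Fin n) (Fin n) ℂ) *
      (P : Matrix (Fin n) (Fin n) ℂ) = 1 :=
    Units.inv_mul P
  have h2 : (P : Matrix (Fin n) (Fin n) ℂ)ᵀ *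
      ((P⁻¹ : GL (Fin n) ℂ) : Matrix (Fin n) (Fin n) ℂ)ᵀ = 1 := by
    rw [← Matrix.transpose_mul, h1, Matrix.transpose_one]
  rw [hP k, Matrix.mul_assoc, Matrix.mul_assoc, h2, Matrix.mul_one, ← Matrix.mul_assoc, h1,
    Matrix.one_mul]

theorem PfaffEquiv.trans {A B D : LinearMatrix n} (h : PfaffEquiv A B) (h' : PfaffEquiv B D) :
    PfaffEquiv A D := by
  obtain ⟨P, hP⟩ := h
  obtain ⟨Q, hQ⟩ := h'
  refine ⟨Q * P, fun k => ?_⟩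
  rw [hQ k, hP k]
  simp [Matrix.transpose_mul, Matrix.mul_assoc]

theorem PfaffEquiv.isDecomposablePfaffian_iff {F : MvPolynomial (Fin 3) ℂ} {A B : LinearMatrix 6}
    (h : PfaffEquiv A B) : IsDecomposablePfaffian F A ↔ IsDecomposablePfaffian F B :=
  ⟨fun ⟨D, hD, hAD⟩ => ⟨D, hD, h.symm.trans hAD⟩, fun ⟨D, hD, hBD⟩ => ⟨D, hD, h.trans hBD⟩⟩

theorem PfaffEquiv.isPfaffianRep {F : MvPolynomial (Fin 3) ℂ} {A B : LinearMatrix 6}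
    (h : PfaffEquiv A B) (hA : IsPfaffianRep F A) : IsPfaffianRep F B := by
  obtain ⟨P, hP⟩ := h
  obtain ⟨hskew, hdet⟩ := hA
  refine ⟨fun k => ?_, ?_⟩
  · rw [hP k]
    simp [Matrix.transpose_mul, hskew k, Matrix.mul_assoc]
  · rw [isDeterminantalRep_iff] at hdet ⊢
    obtain ⟨c, hc, hdet⟩ := hdet
    have hPdet : (P : Matrix (Fin 6) (Fin 6) ℂ).det ≠ 0 :=
      ((Matrix.isUnit_iff_isUnit_det _).1 P.isUnit).ne_zero
    refine ⟨(P : Matrix (Fin 6) (Fin 6) ℂ).det ^ 2 * c, mul_ne_zero (pow_ne_zero _ hPdet) hc,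
      fun v => ?_⟩
    have hsum : ∑ k, v k • B k =
        (P : Matrix (Fin 6) (Fin 6) ℂ) * (∑ k, v k • A k) * (P : Matrix (Fin 6) (Fin 6) ℂ)ᵀ := by
      simp [hP, Matrix.mul_sum, Matrix.sum_mul]
    rw [hsum, Matrix.det_mul, Matrix.det_mul, Matrix.det_transpose, hdet]
    ring

/-- An equivalence may be given by a matrix `P` and a matrix `Q` playing the role of `P⁻ᵗ`. -/
theorem pfaffEquiv_of_mul_eq {A B : LinearMatrix n} (P Q : Matrix (Fin n) (Fin n) ℂ)
    (hPQ : Q * Pᵀ = 1) (h : ∀ k, P * A k = B k * Q) : PfaffEquiv A B := by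
  have hdet : IsUnit P := by
    rw [Matrix.isUnit_iff_isUnit_det, ← Matrix.det_transpose]
    exact IsUnit.of_mul_eq_one_right Q.det (by rw [← Matrix.det_mul, hPQ, Matrix.det_one])
  refine ⟨hdet.unit, fun k => ?_⟩
  rw [IsUnit.unit_spec, h, Matrix.mul_assoc, hPQ, Matrix.mul_one]

theorem IsPfaffianRep.apply_self {F : MvPolynomial (Fin 3) ℂ} {A : LinearMatrix 6}
    (hA : IsPfaffianRep F A) (k : Fin 3) (i : Fin 6) : A k i i = 0 := by
  have h := congrFun (congrFun (hA.1 k) i) i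
  simp only [Matrix.transpose_apply, Matrix.neg_apply] at h
  exact self_eq_neg.1 h

theorem IsPfaffianRep.apply_swap {F : MvPolynomial (Fin 3) ℂ} {A : LinearMatrix 6}
    (hA : IsPfaffianRep F A) (k : Fin 3) (i j : Fin 6) : A k j i = -A k i j :=
  congrFun (congrFun (hA.1 k) i) j

theorem eval_weierstrassCubic (l : ℂ) (v : Fin 3 → ℂ) :
    eval v (weierstrassCubic l) = v 1 * v 2 ^ 2 - v 0 * (v 0 - v 1) * (v 0 - l * v 1) := by
  simp [weierstrassCubic]

theorem isPfaffianRep_of_pfaffianSix {F : MvPolynomial (Fin 3) ℂ} {A : LinearMatrix 6}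
    (hA : ∀ k, (A k)ᵀ = -A k)
    (h : ∀ v : Fin 3 → ℂ, pfaffianSix (∑ k, v k • A k) = -eval v F) : IsPfaffianRep F A := by
  refine ⟨hA, (isDeterminantalRep_iff _ _ _).2 ⟨1, one_ne_zero, fun v => ?_⟩⟩
  have hs (k : Fin 3) (i j : Fin 6) : A k j i = -A k i j := congrFun (congrFun (hA k) i) j
  have h0 (k : Fin 3) (i : Fin 6) : A k i i = 0 := self_eq_neg.1 (hs k i i)
  rw [det_eq_pfaffianSix_sq, h]
  · ring
  · simp [Matrix.sum_apply, h0]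
  · intro i j
    simp only [Matrix.sum_apply, Matrix.smul_apply, ← Finset.sum_neg_distrib]
    exact Finset.sum_congr rfl fun k _ => by rw [hs k i j, smul_neg]

/-- The determinant determines the pfaffian up to sign, and the coefficient of `x` fixes the sign:
`canonicalX` has pfaffian `1`, while `x ^ 3` has coefficient `-1` in the cubic. -/
theorem IsPfaffianRep.pfaffianSix_eq {l : ℂ} {A : LinearMatrix 6}
    (hA : IsPfaffianRep (weierstrassCubic l) A) (h0 : A 0 = canonicalX) (v : Fin 3 → ℂ) :
    pfaffianSix (∑ k, v k • A k) = -eval v (weierstrassCubic l) := by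
  have heval (v : Fin 3 → ℂ) : eval v (pfaffianSix A.toPoly) = pfaffianSix (∑ k, v k • A k) := by
    simp [pfaffianSix, toPoly_apply, Matrix.sum_apply]
  have hx : pfaffianSix (∑ k, (![1, 0, 0] : Fin 3 → ℂ) k • A k) = 1 := by
    simp [Fin.sum_univ_succ, h0, pfaffianSix, canonicalX, skewOfUpper]
  have hFx : eval ![1, 0, 0] (weierstrassCubic l) = -1 := by
    simp [eval_weierstrassCubic]
  have hdet : A.toPoly.det = pfaffianSix A.toPoly ^ 2 := by
    refine det_eq_pfaffianSix_sq _ (fun i => ?_) (fun i j => ?_)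
    · simp [toPoly_apply, hA.apply_self]
    · simp only [toPoly_apply, ← Finset.sum_neg_distrib]
      exact Finset.sum_congr rfl fun k _ => by rw [hA.apply_swap k i j, C_neg, mul_neg]
  obtain ⟨c, -, hc⟩ := hA.2
  rw [hdet] at hc
  have hc1 : c = 1 := by
    have := congrArg (eval ![1, 0, 0]) hc
    simp only [map_pow, map_mul, heval, hx, hFx, eval_C] at this
    linear_combination -this
  rw [hc1, C_1, one_mul] at hc
  rcases sq_eq_sq_iff_eq_or_eq_neg.1 hc with h | h
  · have := congrArg (eval ![1, 0, 0]) h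
    rw [heval, hx, hFx] at this
    norm_num at this
  · rw [← heval, h, map_neg]

/-! ### Block decompositions -/

theorem IsDecomposablePfaffian.not_isIndecomposable {F : MvPolynomial (Fin 3) ℂ}
    {A : LinearMatrix 6} (h : IsDecomposablePfaffian F A) : ¬ IsIndecomposable A := by
  obtain ⟨B, -, P, hP⟩ := h
  -- Swapping the two block columns of `[0, B; -Bᵗ, 0]` makes it block diagonal.
  set S : Matrix (Fin 6) (Fin 6) ℂ :=
    Matrix.reindex (finSumFinEquiv (m := 3) (n := 3)) (finSumFinEquiv (m := 3) (n := 3))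
      (Matrix.fromBlocks 0 1 1 0) with hS
  have hSS : S * S = 1 := by
    rw [hS]
    simp only [Matrix.reindex_apply]
    rw [Matrix.submatrix_mul_equiv, Matrix.fromBlocks_multiply]
    simp
  refine fun hA => hA ⟨3, 3, finSumFinEquiv, B, fun k => -(B k)ᵀ, by norm_num, by norm_num, P,
    ⟨(P : Matrix (Fin 6) (Fin 6) ℂ)ᵀ * S, S * ((P⁻¹ : GL (Fin 6) ℂ) : Matrix (Fin 6) (Fin 6) ℂ)ᵀ,
      ?_, ?_⟩, fun k => ?_⟩
  · rw [Matrix.mul_assoc, ← Matrix.mul_assoc S, hSS, Matrix.one_mul, ← Matrix.transpose_mul,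
      Units.inv_mul, Matrix.transpose_one]
  · rw [Matrix.mul_assoc, ← Matrix.mul_assoc _ _ S, ← Matrix.transpose_mul, Units.mul_inv,
      Matrix.transpose_one, Matrix.one_mul, hSS]
  · change _ = P.1 * A k * (P.1ᵀ * S)
    rw [← Matrix.mul_assoc, ← hP k, skewBlock, hS]
    simp only [Matrix.reindex_apply]
    rw [Matrix.submatrix_mul_equiv, Matrix.fromBlocks_multiply]
    simp

/-- A block decomposition of `A` gives an idempotent endomorphism `(U, W)` of `A` that is neither
zero nor the identity: conjugate the projection onto the first block. -/
theorem isIndecomposable_of_idempotent {n : ℕ} {A : LinearMatrix n}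
    (h : ∀ U W : Matrix (Fin n) (Fin n) ℂ, (∀ k, U * A k = A k * W) → U * U = U →
      U = 0 ∨ U = 1) : IsIndecomposable A := by
  rintro ⟨p, q, e, A₁, A₂, hp, hq, X, Y, hXY⟩
  set E : Matrix (Fin n) (Fin n) ℂ := Matrix.reindex e e (Matrix.fromBlocks 1 0 0 0) with hE
  have hEE : E * E = E := by
    rw [hE]
    simp only [Matrix.reindex_apply]
    rw [Matrix.submatrix_mul_equiv, Matrix.fromBlocks_multiply]
    simp
  have hcomm (k) : E * (X.1 * A k * Y.1) = X.1 * A k * Y.1 * E := by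
    rw [← hXY k, hE]
    simp only [Matrix.reindex_apply]
    rw [Matrix.submatrix_mul_equiv, Matrix.submatrix_mul_equiv, Matrix.fromBlocks_multiply,
      Matrix.fromBlocks_multiply]
    simp
  have hX : X.inv * X.1 = 1 := X.inv_val
  have hX' : X.1 * X.inv = 1 := X.val_inv
  have hY : Y.1 * Y.inv = 1 := Y.val_inv
  have hU : X.inv * E * X.1 = 0 ∨ X.inv * E * X.1 = 1 := by
    refine h _ (Y.1 * E * Y.inv) (fun k => ?_) ?_
    · calc X.inv * E * X.1 * A k = X.inv * (E * (X.1 * A k * Y.1)) * Y.inv := by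
            simp only [Matrix.mul_assoc, hY, Matrix.mul_one]
        _ = (X.inv * X.1) * (A k * (Y.1 * E * Y.inv)) := by
            rw [hcomm]
            simp only [Matrix.mul_assoc]
        _ = A k * (Y.1 * E * Y.inv) := by rw [hX, Matrix.one_mul]
    · calc X.inv * E * X.1 * (X.inv * E * X.1) = X.inv * (E * ((X.1 * X.inv) * E)) * X.1 := by
            simp only [Matrix.mul_assoc]
        _ = X.inv * E * X.1 := by rw [hX', Matrix.one_mul, hEE]
  have hEU : E = X.1 * (X.inv * E * X.1) * X.inv := by
    calc E = (X.1 * X.inv) * E * (X.1 * X.inv) := by rw [hX', Matrix.one_mul, Matrix.mul_one]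
      _ = _ := by simp only [Matrix.mul_assoc]
  rcases hU with hU | hU
  · have h1 : E (e (Sum.inl ⟨0, hp⟩)) (e (Sum.inl ⟨0, hp⟩)) = 1 := by simp [hE]
    rw [hEU, hU] at h1
    simp at h1
  · have h1 : E (e (Sum.inr ⟨0, hq⟩)) (e (Sum.inr ⟨0, hq⟩)) = 0 := by simp [hE]
    rw [hEU, hU, Matrix.mul_one, hX'] at h1
    simp at h1

/-! ### Normal forms and their intertwiners -/

/-- The representation attached to a number `t` and the traceless matrix
`K = [p, q; r, -p]`. It specialises to `decomposableRep l t s` for `K = [s, 0; 0, -s]` and to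
`indecomposableRep l t` for `K = [0, -1; 0, 0]`. -/
def normalRep (l t p q r : ℂ) : LinearMatrix 6 :=
  ![canonicalX,
    skewOfUpper
      !![0, -q, 0, (3 * t ^ 2 - 2 * t * (1 + l) - (1 - l) ^ 2) / 4, p, (t - 1 - l) / 2;
         0, 0, 0, -p, -t, 0;
         0, 0, 0, (t - 1 - l) / 2, 0, -1;
         0, 0, 0, 0, r, 0;
         0, 0, 0, 0, 0, 0;
         0, 0, 0, 0, 0, 0],
    canonicalZ]

theorem decomposableRep_eq_normalRep (l t s : ℂ) :
    decomposableRep l t s = normalRep l t s 0 0 := by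
  simp [decomposableRep, normalRep]

theorem indecomposableRep_eq_normalRep (l t : ℂ) :
    indecomposableRep l t = normalRep l t 0 (-1) 0 := by
  simp [indecomposableRep, normalRep]

/-- The `6 × 6` matrix with blocks `a, b, c, d` times the identity of size three. -/
def scalarBlocks (a b c d : ℂ) : Matrix (Fin 6) (Fin 6) ℂ :=
  !![a, 0, 0, b, 0, 0;
     0, a, 0, 0, b, 0;
     0, 0, a, 0, 0, b;
     c, 0, 0, d, 0, 0;
     0, c, 0, 0, d, 0;
     0, 0, c, 0, 0, d]

theorem canonicalX_mul_self : canonicalX * canonicalX = -1 := by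
  ext i j
  fin_cases i <;> fin_cases j <;>
    simp [canonicalX, skewOfUpper, Matrix.mul_apply, Fin.sum_univ_succ]

/-- The `6 × 6` matrix whose four blocks are the upper triangular Toeplitz matrices with the given
first rows. -/
def toeplitzBlocks (a b c d : Fin 3 → ℂ) : Matrix (Fin 6) (Fin 6) ℂ :=
  !![a 0, a 1, a 2, b 0, b 1, b 2;
     0, a 0, a 1, 0, b 0, b 1;
     0, 0, a 0, 0, 0, b 0;
     c 0, c 1, c 2, d 0, d 1, d 2;
     0, c 0, c 1, 0, d 0, d 1;
     0, 0, c 0, 0, 0, d 0]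

theorem canonicalZ_mul_canonicalX : canonicalZ * canonicalX =
    !![0, -1, 0, 0, 0, 0; 0, 0, -1, 0, 0, 0; 0, 0, 0, 0, 0, 0;
       0, 0, 0, 0, -1, 0; 0, 0, 0, 0, 0, -1; 0, 0, 0, 0, 0, 0] := by
  ext i j
  fin_cases i <;> fin_cases j <;>
    simp [canonicalX, canonicalZ, skewOfUpper, Matrix.mul_apply, Fin.sum_univ_succ]

theorem normalRep_one_mul_canonicalX (l t p q r : ℂ) : normalRep l t p q r 1 * canonicalX =
    !![-((t - 1 - l) / 2), -p, -((3 * t ^ 2 - 2 * t * (1 + l) - (1 - l) ^ 2) / 4), 0, -q, 0;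
       0, t, p, 0, 0, q;
       1, 0, -((t - 1 - l) / 2), 0, 0, 0;
       0, -r, 0, -((t - 1 - l) / 2), p, -((3 * t ^ 2 - 2 * t * (1 + l) - (1 - l) ^ 2) / 4);
       0, 0, r, 0, t, -p;
       0, 0, 0, 1, 0, -((t - 1 - l) / 2)] := by
  ext i j
  fin_cases i <;> fin_cases j <;>
    simp [normalRep, canonicalX, canonicalZ, skewOfUpper, Matrix.mul_apply, Fin.sum_univ_succ]

/-- The commutant of a nilpotent matrix with two Jordan blocks of size three. -/
theorem eq_toeplitzBlocks {U : Matrix (Fin 6) (Fin 6) ℂ}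
    (h : U * (canonicalZ * canonicalX) = canonicalZ * canonicalX * U) :
    ∃ a b c d : Fin 3 → ℂ, U = toeplitzBlocks a b c d := by
  rw [canonicalZ_mul_canonicalX] at h
  simp [← Matrix.ext_iff, Fin.forall_fin_succ, Matrix.mul_apply, Fin.sum_univ_succ,
    Matrix.vecMul, dotProduct] at h
  refine ⟨![U 0 0, U 0 1, U 0 2], ![U 0 3, U 0 4, U 0 5], ![U 3 0, U 3 1, U 3 2],
    ![U 3 3, U 3 4, U 3 5], ?_⟩
  ext i j
  fin_cases i <;> fin_cases j <;> simp [toeplitzBlocks] <;> grind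

/-- Intertwiners that commute with the nilpotent part of the pencil, compared on the coefficient
of `y`: the higher coefficients of the Toeplitz blocks vanish. -/
theorem toeplitzBlocks_intertwiner {l t p q r t' p' q' r' : ℂ} {a b c d : Fin 3 → ℂ}
    (h : toeplitzBlocks a b c d * (normalRep l t p q r 1 * canonicalX) =
      normalRep l t' p' q' r' 1 * canonicalX * toeplitzBlocks a b c d) :
    toeplitzBlocks a b c d = scalarBlocks (a 0) (b 0) (c 0) (d 0) ∧
      (toeplitzBlocks a b c d ≠ 0 → t = t') ∧
      a 0 * p + b 0 * r = p' * a 0 + q' * c 0 ∧ a 0 * q - b 0 * p = p' * b 0 + q' * d 0 ∧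
      c 0 * p + d 0 * r = r' * a 0 - p' * c 0 ∧ c 0 * q - d 0 * p = r' * b 0 - p' * d 0 := by
  rw [normalRep_one_mul_canonicalX, normalRep_one_mul_canonicalX] at h
  have e (i j) := congrFun (congrFun h i) j
  simp only [Matrix.mul_apply, Fin.sum_univ_succ] at e
  have a1 : a 1 = 0 := by simpa [toeplitzBlocks] using e 1 0
  have b1 : b 1 = 0 := by simpa [toeplitzBlocks] using e 1 3
  have c1 : c 1 = 0 := by simpa [toeplitzBlocks] using e 4 0
  have d1 : d 1 = 0 := by simpa [toeplitzBlocks] using e 4 3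
  have ta : a 0 * t = t' * a 0 := by simpa [toeplitzBlocks, a1, b1, c1, d1] using e 1 1
  have tb : b 0 * t = t' * b 0 := by simpa [toeplitzBlocks, a1, b1, c1, d1] using e 1 4
  have tc : c 0 * t = t' * c 0 := by simpa [toeplitzBlocks, a1, b1, c1, d1] using e 4 1
  have td : d 0 * t = t' * d 0 := by simpa [toeplitzBlocks, a1, b1, c1, d1] using e 4 4
  have a2 := e 0 0
  have b2 := e 0 3
  have c2 := e 3 0
  have d2 := e 3 3
  have r1 := e 0 1
  have r2 := e 0 4
  have r3 := e 3 1
  have r4 := e 3 4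
  simp [toeplitzBlocks, a1, b1, c1, d1] at a2 b2 c2 d2 r1 r2 r3 r4
  replace a2 : a 2 = 0 := by linear_combination a2 + ta / 2
  replace b2 : b 2 = 0 := by linear_combination b2 + tb / 2
  replace c2 : c 2 = 0 := by linear_combination c2 + tc / 2
  replace d2 : d 2 = 0 := by linear_combination d2 + td / 2
  refine ⟨?_, ?_, ?_, ?_, ?_, ?_⟩
  · simp [toeplitzBlocks, scalarBlocks, a1, b1, c1, d1, a2, b2, c2, d2]
  · intro hne
    by_contra htt
    have key {x : ℂ} (hx : x * t = t' * x) : x = 0 := by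
      have : x * (t - t') = 0 := by linear_combination hx
      exact (mul_eq_zero.1 this).resolve_right (sub_ne_zero.2 htt)
    apply hne
    ext i j
    fin_cases i <;> fin_cases j <;>
      simp [toeplitzBlocks, key ta, key tb, key tc, key td, a1, b1, c1, d1, a2, b2, c2, d2]
  · linear_combination -r1
  · linear_combination -r2
  · linear_combination -r3
  · linear_combination -r4

/-- An intertwiner of two normal forms consists of scalar blocks. It comes from a
`2 × 2` matrix `g = [a, b; c, d]` with `g K = K' g`, and `t = t'` unless it vanishes. -/
theorem intertwiner_normalRep {l t p q r t' p' q' r' : ℂ} {U W : Matrix (Fin 6) (Fin 6) ℂ}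
    (h : ∀ k, U * normalRep l t p q r k = normalRep l t' p' q' r' k * W) :
    ∃ a b c d : ℂ, U = scalarBlocks a b c d ∧ (U ≠ 0 → t = t') ∧
      a * p + b * r = p' * a + q' * c ∧ a * q - b * p = p' * b + q' * d ∧
      c * p + d * r = r' * a - p' * c ∧ c * q - d * p = r' * b - p' * d := by
  have h0 : U * canonicalX = canonicalX * W := h 0
  have hW : W * canonicalX = canonicalX * U := by
    have : W = -(canonicalX * (U * canonicalX)) := by
      rw [h0, ← Matrix.mul_assoc, canonicalX_mul_self, Matrix.neg_mul, Matrix.one_mul, neg_neg]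
    rw [this, Matrix.neg_mul, Matrix.mul_assoc, Matrix.mul_assoc, canonicalX_mul_self]
    simp
  have hk (k) : U * (normalRep l t p q r k * canonicalX) =
      normalRep l t' p' q' r' k * canonicalX * U := by
    rw [← Matrix.mul_assoc, h, Matrix.mul_assoc, hW, Matrix.mul_assoc]
  obtain ⟨a, b, c, d, rfl⟩ := eq_toeplitzBlocks (hk 2)
  exact ⟨a 0, b 0, c 0, d 0, toeplitzBlocks_intertwiner (hk 1)⟩

set_option maxHeartbeats 1000000 in
theorem scalarBlocks_mul_normalRep {l t p q r p' q' r' a b c d : ℂ}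
    (h1 : a * p + b * r = p' * a + q' * c) (h2 : a * q - b * p = p' * b + q' * d)
    (h3 : c * p + d * r = r' * a - p' * c) (h4 : c * q - d * p = r' * b - p' * d) (k : Fin 3) :
    scalarBlocks a b c d * normalRep l t p q r k =
      normalRep l t p' q' r' k * scalarBlocks d (-c) (-b) a := by
  ext i j
  fin_cases k <;> fin_cases i <;> fin_cases j <;>
    simp [scalarBlocks, normalRep, canonicalX, canonicalZ, skewOfUpper, Matrix.mul_apply,
      Fin.sum_univ_succ] <;> grind

/-- Conjugating `K` by a matrix of determinant one does not change the equivalence class. -/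
theorem pfaffEquiv_normalRep {l t p q r p' q' r' : ℂ} (a b c d : ℂ) (hdet : a * d - b * c = 1)
    (h1 : a * p + b * r = p' * a + q' * c) (h2 : a * q - b * p = p' * b + q' * d)
    (h3 : c * p + d * r = r' * a - p' * c) (h4 : c * q - d * p = r' * b - p' * d) :
    PfaffEquiv (normalRep l t p q r) (normalRep l t p' q' r') := by
  refine pfaffEquiv_of_mul_eq (scalarBlocks a b c d) (scalarBlocks d (-c) (-b) a) ?_
    (scalarBlocks_mul_normalRep h1 h2 h3 h4)
  ext i j
  fin_cases i <;> fin_cases j <;>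
    simp [scalarBlocks, Matrix.mul_apply, Fin.sum_univ_succ] <;> grind

/-! ### The normal forms are pfaffian representations -/

theorem skewOfUpper_transpose (U : Matrix (Fin 6) (Fin 6) ℂ) :
    (skewOfUpper U)ᵀ = -skewOfUpper U := by
  simp [skewOfUpper]

/-- Minus the determinant of `K = [p, q; r, -p]` is what the pfaffian of a normal form sees of
it. -/
theorem pfaffianSix_normalRep (l t p q r : ℂ) (v : Fin 3 → ℂ) :
    pfaffianSix (∑ k, v k • normalRep l t p q r k) = -eval v (weierstrassCubic l) +
      v 1 ^ 3 * (p ^ 2 + q * r - t * (t - 1) * (t - l)) := by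
  rw [eval_weierstrassCubic]
  simp [pfaffianSix, Fin.sum_univ_succ, normalRep, canonicalX, canonicalZ, skewOfUpper]
  ring

theorem isPfaffianRep_normalRep {l t p q r : ℂ} (h : p ^ 2 + q * r = t * (t - 1) * (t - l)) :
    IsPfaffianRep (weierstrassCubic l) (normalRep l t p q r) := by
  refine isPfaffianRep_of_pfaffianSix (fun k => ?_) fun v => ?_
  · fin_cases k <;> exact skewOfUpper_transpose _
  · rw [pfaffianSix_normalRep, h, sub_self, mul_zero, add_zero]

theorem isDecomposablePfaffian_decomposableRep {l t s : ℂ} (h : s ^ 2 = t * (t - 1) * (t - l)) :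
    IsDecomposablePfaffian (weierstrassCubic l) (decomposableRep l t s) := by
  let B : LinearMatrix 3 :=
    ![!![0, 0, 1; 0, 1, 0; 1, 0, 0],
      !![(3 * t ^ 2 - 2 * t * (1 + l) - (1 - l) ^ 2) / 4, s, (t - 1 - l) / 2;
         -s, -t, 0;
         (t - 1 - l) / 2, 0, -1],
      !![0, 1, 0; 1, 0, 0; 0, 0, 0]]
  have hB : decomposableRep l t s = skewBlock B := by
    have e0 : finSumFinEquiv.symm (0 : Fin 6) = (Sum.inl 0 : Fin 3 ⊕ Fin 3) := rfl
    have e1 : finSumFinEquiv.symm (1 : Fin 6) = (Sum.inl 1 : Fin 3 ⊕ Fin 3) := rfl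
    have e2 : finSumFinEquiv.symm (2 : Fin 6) = (Sum.inl 2 : Fin 3 ⊕ Fin 3) := rfl
    have e3 : finSumFinEquiv.symm (3 : Fin 6) = (Sum.inr 0 : Fin 3 ⊕ Fin 3) := rfl
    have e4 : finSumFinEquiv.symm (4 : Fin 6) = (Sum.inr 1 : Fin 3 ⊕ Fin 3) := rfl
    have e5 : finSumFinEquiv.symm (5 : Fin 6) = (Sum.inr 2 : Fin 3 ⊕ Fin 3) := rfl
    funext k
    ext i j
    fin_cases k <;> fin_cases i <;> fin_cases j <;>
      simp [skewBlock, decomposableRep, canonicalX, canonicalZ, skewOfUpper, B, e0, e1, e2, e3,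
        e4, e5]
  refine ⟨B, (isDeterminantalRep_iff _ _ _).2 ⟨1, one_ne_zero, fun v => ?_⟩, ?_⟩
  · rw [eval_weierstrassCubic, Matrix.det_fin_three]
    simp [Fin.sum_univ_succ, B]
    linear_combination -(v 1) ^ 3 * h
  · rw [hB]
    exact PfaffEquiv.refl _

/-! ### Equivalences between the normal forms -/

theorem PfaffEquiv.exists_intertwiner {n : ℕ} {A B : LinearMatrix n} (h : PfaffEquiv A B) :
    ∃ U W : Matrix (Fin n) (Fin n) ℂ, IsUnit U ∧ ∀ k, U * A k = B k * W := by
  obtain ⟨P, hP⟩ := h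
  refine ⟨P.1, P.invᵀ, P.isUnit, fun k => ?_⟩
  have : P.1ᵀ * P.invᵀ = 1 := by rw [← Matrix.transpose_mul, P.inv_val, Matrix.transpose_one]
  rw [hP k, Matrix.mul_assoc, this, Matrix.mul_one]

/-- Endomorphisms of `indecomposableRep l t` are the polynomials in a nonzero nilpotent `2 × 2`
matrix, which form a local ring. -/
theorem isIndecomposable_indecomposableRep (l t : ℂ) :
    IsIndecomposable (indecomposableRep l t) := by
  rw [indecomposableRep_eq_normalRep]
  refine isIndecomposable_of_idempotent fun U W hUW hUU => ?_
  obtain ⟨a, b, c, d, rfl, -, h1, h2, -, -⟩ := intertwiner_normalRep hUW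
  obtain rfl : c = 0 := by linear_combination h1
  obtain rfl : a = d := by linear_combination -h2
  have ha := congrFun (congrFun hUU 0) 0
  have hb := congrFun (congrFun hUU 0) 3
  simp only [scalarBlocks, Matrix.mul_apply, Fin.sum_univ_succ] at ha hb
  simp at ha hb
  have ha : a * (a - 1) = 0 := by linear_combination ha
  rcases mul_eq_zero.1 ha with ha | ha
  · have hb : b = 0 := by linear_combination -hb + 2 * b * ha
    left
    ext i j
    fin_cases i <;> fin_cases j <;> simp [scalarBlocks, ha, hb]
  · have hb : b = 0 := by linear_combination hb - 2 * b * ha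
    right
    ext i j
    fin_cases i <;> fin_cases j <;> simp [scalarBlocks, sub_eq_zero.1 ha, hb]

theorem eq_of_pfaffEquiv_indecomposableRep {l t t' : ℂ}
    (h : PfaffEquiv (indecomposableRep l t) (indecomposableRep l t')) : t = t' := by
  rw [indecomposableRep_eq_normalRep, indecomposableRep_eq_normalRep] at h
  obtain ⟨U, W, hU, hUW⟩ := h.exists_intertwiner
  obtain ⟨-, -, -, -, -, ht, -⟩ := intertwiner_normalRep hUW
  exact ht hU.ne_zero

theorem pfaffEquiv_decomposableRep_iff {l t s t' s' : ℂ} :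
    PfaffEquiv (decomposableRep l t s) (decomposableRep l t' s') ↔
      t = t' ∧ (s = s' ∨ s = -s') := by
  rw [decomposableRep_eq_normalRep, decomposableRep_eq_normalRep]
  constructor
  · intro h
    obtain ⟨U, W, hU, hUW⟩ := h.exists_intertwiner
    obtain ⟨a, b, c, d, rfl, ht, h1, h2, h3, h4⟩ := intertwiner_normalRep hUW
    refine ⟨ht hU.ne_zero, ?_⟩
    by_contra! hs
    have h1 : a * (s - s') = 0 := by linear_combination h1
    have h2 : b * (s + s') = 0 := by linear_combination -h2
    have h3 : c * (s + s') = 0 := by linear_combination h3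
    have h4 : d * (s - s') = 0 := by linear_combination -h4
    have hm : s - s' ≠ 0 := sub_ne_zero.2 hs.1
    have hp : s + s' ≠ 0 := fun h => hs.2 (eq_neg_of_add_eq_zero_left h)
    have ha := (mul_eq_zero.1 h1).resolve_right hm
    have hb := (mul_eq_zero.1 h2).resolve_right hp
    have hc := (mul_eq_zero.1 h3).resolve_right hp
    have hd := (mul_eq_zero.1 h4).resolve_right hm
    apply hU.ne_zero
    ext i j
    fin_cases i <;> fin_cases j <;> simp [scalarBlocks, ha, hb, hc, hd]
  · rintro ⟨rfl, rfl | rfl⟩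
    · exact PfaffEquiv.refl _
    -- The Weyl element exchanges the two eigenvalues.
    · exact pfaffEquiv_normalRep 0 1 (-1) 0 (by ring) (by ring) (by ring) (by ring) (by ring)

/-- The Jordan normal form of `K`: it is zero, or diagonalisable with eigenvalues `s` and `-s`,
or nilpotent. -/
theorem normalRep_pfaffEquiv_canonical {l t p q r : ℂ}
    (h : p ^ 2 + q * r = t * (t - 1) * (t - l)) :
    (∃ s, s ^ 2 = t * (t - 1) * (t - l) ∧
      PfaffEquiv (normalRep l t p q r) (decomposableRep l t s)) ∨
    (t ∈ ({0, 1, l} : Set ℂ) ∧ PfaffEquiv (normalRep l t p q r) (indecomposableRep l t)) := by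
  simp only [decomposableRep_eq_normalRep, indecomposableRep_eq_normalRep]
  obtain ⟨s, hs⟩ := IsAlgClosed.exists_pow_nat_eq (p ^ 2 + q * r) (n := 2) two_pos
  rcases eq_or_ne s 0 with rfl | hs0
  · have hpqr : p ^ 2 + q * r = 0 := by rw [← hs]; ring
    by_cases hq : q = 0
    · subst hq
      obtain rfl : p = 0 := by simpa using hpqr
      by_cases hr : r = 0
      · subst hr
        exact Or.inl ⟨0, by rw [← h]; ring, PfaffEquiv.refl _⟩
      · right
        obtain ⟨k, hk⟩ := IsAlgClosed.exists_pow_nat_eq (r⁻¹) (n := 2) two_pos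
        have hk : k ^ 2 * r = 1 := by rw [hk, inv_mul_cancel₀ hr]
        refine ⟨?_, pfaffEquiv_normalRep 0 k (-(k * r)) 0 ?_ ?_ ?_ ?_ ?_⟩
        · have : t * (t - 1) * (t - l) = 0 := by rw [← h]; ring
          simpa [sub_eq_zero, or_assoc] using this
        all_goals first | ring1 | linear_combination hk
    · right
      obtain ⟨k, hk⟩ := IsAlgClosed.exists_pow_nat_eq (-q⁻¹) (n := 2) two_pos
      have hk : k ^ 2 * q = -1 := by rw [hk, neg_mul, inv_mul_cancel₀ hq]
      -- The rows are a vector `v` with `v K ≠ 0` and `-v K`.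
      refine ⟨?_, pfaffEquiv_normalRep k 0 (-(k * p)) (-(k * q)) ?_ ?_ ?_ ?_ ?_⟩
      · have : t * (t - 1) * (t - l) = 0 := by rw [← h, hpqr]
        simpa [sub_eq_zero, or_assoc] using this
      all_goals first | ring1 | linear_combination -hk | linear_combination -k * hpqr
  · left
    have h2s : 2 * s ≠ 0 := mul_ne_zero two_ne_zero hs0
    by_cases hr : r = 0
    · by_cases hq : q = 0
      · subst hq hr
        exact ⟨p, by rw [← h]; ring, PfaffEquiv.refl _⟩
      -- The rows are left eigenvectors of `K` for `s` and `-s`, the first one rescaled.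
      · have hne : 2 * s * q ≠ 0 := mul_ne_zero h2s hq
        have hinv : (2 * s * q)⁻¹ * (2 * s * q) = 1 := inv_mul_cancel₀ hne
        refine ⟨s, by rw [hs, h], pfaffEquiv_normalRep ((2 * s * q)⁻¹ * (s + p))
          ((2 * s * q)⁻¹ * q) (p - s) q ?_ ?_ ?_ ?_ ?_⟩
        · linear_combination hinv
        · linear_combination -(2 * s * q)⁻¹ * hs
        · ring
        · linear_combination -hs
        · ring
    · have hne : -(2 * s * r) ≠ 0 := neg_ne_zero.2 (mul_ne_zero h2s hr)
      have hinv : (-(2 * s * r))⁻¹ * (-(2 * s * r)) = 1 := inv_mul_cancel₀ hne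
      refine ⟨s, by rw [hs, h], pfaffEquiv_normalRep ((-(2 * s * r))⁻¹ * r)
        ((-(2 * s * r))⁻¹ * (s - p)) r (-s - p) ?_ ?_ ?_ ?_ ?_⟩
      · linear_combination hinv
      · ring
      · linear_combination -(-(2 * s * r))⁻¹ * hs
      · ring
      · linear_combination -hs

/-! ### Smoothness -/

/-- For `l = 0` and `l = 1` the cubic is singular at `(0 : 1 : 0)` and `(1 : 1 : 0)`. -/
theorem ne_of_isSmoothCurve {l : ℂ} (hF : IsSmoothCurve (weierstrassCubic l)) :
    l ≠ 0 ∧ l ≠ 1 := by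
  constructor
  · rintro rfl
    obtain ⟨i, hi⟩ := hF ![0, 1, 0] (fun h => one_ne_zero (congrFun h 1))
      (by simp [weierstrassCubic])
    apply hi
    fin_cases i <;> simp [weierstrassCubic, pderiv_X]
  · rintro rfl
    obtain ⟨i, hi⟩ := hF ![1, 1, 0] (fun h => one_ne_zero (congrFun h 1))
      (by simp [weierstrassCubic])
    apply hi
    fin_cases i <;> simp [weierstrassCubic, pderiv_X]

/-! ### Reduction of the coefficient of `y` -/

theorem toeplitzBlocks_mul_canonicalX (p q r a b c d : ℂ) :
    toeplitzBlocks ![1, p, a] ![0, q, b] ![0, r, c] ![1, -p, d] * canonicalX =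
      !![-b, -q, 0, a, p, 1;
         -q, 0, 0, p, 1, 0;
         0, 0, 0, 1, 0, 0;
         -d, p, -1, c, r, 0;
         p, -1, 0, r, 0, 0;
         -1, 0, 0, 0, 0, 0] := by
  ext i j
  rw [Matrix.mul_apply]
  fin_cases i <;> fin_cases j <;>
    simp [Fin.sum_univ_succ, toeplitzBlocks, canonicalX, skewOfUpper]

/-- Toeplitz block matrices of determinant one over `ℂ[ε] / ε ^ 3` that are congruent to the
identity modulo `ε` stabilise the coefficient of `x`. -/
theorem toeplitzBlocks_stabilizes_canonicalX {p q r a b c d : ℂ} (h : a + d = p ^ 2 + q * r) :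
    toeplitzBlocks ![1, p, a] ![0, q, b] ![0, r, c] ![1, -p, d] * canonicalX *
      (toeplitzBlocks ![1, p, a] ![0, q, b] ![0, r, c] ![1, -p, d])ᵀ = canonicalX := by
  rw [toeplitzBlocks_mul_canonicalX]
  ext i j
  rw [Matrix.mul_apply]
  fin_cases i <;> fin_cases j <;>
    simp [Fin.sum_univ_succ, toeplitzBlocks, canonicalX, skewOfUpper] <;> grind

theorem toeplitzBlocks_commute (a b c d : Fin 3 → ℂ) :
    toeplitzBlocks a b c d * (canonicalZ * canonicalX) =
      canonicalZ * canonicalX * toeplitzBlocks a b c d := by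
  rw [canonicalZ_mul_canonicalX]
  ext i j
  rw [Matrix.mul_apply, Matrix.mul_apply]
  fin_cases i <;> fin_cases j <;> simp [Fin.sum_univ_succ, toeplitzBlocks]

/-- Toeplitz block matrices commute with `canonicalZ * canonicalX`, so those that stabilise
`canonicalX` also stabilise `canonicalZ`. -/
theorem toeplitzBlocks_stabilizes_canonicalZ {a b c d : Fin 3 → ℂ}
    (h : toeplitzBlocks a b c d * canonicalX * (toeplitzBlocks a b c d)ᵀ = canonicalX) :
    toeplitzBlocks a b c d * canonicalZ * (toeplitzBlocks a b c d)ᵀ = canonicalZ := by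
  have hZ : canonicalZ = -(canonicalZ * canonicalX * canonicalX) := by
    rw [Matrix.mul_assoc, canonicalX_mul_self, Matrix.mul_neg, neg_neg, Matrix.mul_one]
  have hcomm := toeplitzBlocks_commute a b c d
  generalize toeplitzBlocks a b c d = G at h hcomm
  calc G * canonicalZ * Gᵀ = -(G * (canonicalZ * canonicalX) * canonicalX * Gᵀ) := by
        conv_lhs => rw [hZ]
        simp only [Matrix.mul_neg, Matrix.neg_mul, Matrix.mul_assoc]
    _ = -(canonicalZ * canonicalX * (G * canonicalX * Gᵀ)) := by
        rw [hcomm]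
        simp only [Matrix.mul_assoc]
    _ = canonicalZ := by rw [h, ← hZ]

theorem isUnit_of_mul_mul_transpose_eq_canonicalX {G K : Matrix (Fin 6) (Fin 6) ℂ}
    (h : G * K * Gᵀ = canonicalX) : IsUnit G := by
  have h1 : G * (K * Gᵀ * -canonicalX) = 1 := by
    rw [Matrix.mul_neg, Matrix.mul_neg, ← Matrix.mul_assoc, ← Matrix.mul_assoc, h,
      canonicalX_mul_self, neg_neg]
  rw [Matrix.isUnit_iff_isUnit_det]
  exact IsUnit.of_mul_eq_one _ (by rw [← Matrix.det_mul, h1, Matrix.det_one])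

theorem pfaffEquiv_of_toeplitzBlocks {A : LinearMatrix 6} (h0 : A 0 = canonicalX)
    (h2 : A 2 = canonicalZ) {p q r a b c d : ℂ} (h : a + d = p ^ 2 + q * r) :
    PfaffEquiv A ![canonicalX,
      toeplitzBlocks ![1, p, a] ![0, q, b] ![0, r, c] ![1, -p, d] * A 1 *
        (toeplitzBlocks ![1, p, a] ![0, q, b] ![0, r, c] ![1, -p, d])ᵀ,
      canonicalZ] := by
  have hX := toeplitzBlocks_stabilizes_canonicalX (b := b) (c := c) h
  have hZ := toeplitzBlocks_stabilizes_canonicalZ hX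
  refine ⟨(isUnit_of_mul_mul_transpose_eq_canonicalX hX).unit, fun k => ?_⟩
  rw [IsUnit.unit_spec]
  fin_cases k
  · simp [h0, hX]
  · rfl
  · simp [h2, hZ]

theorem mul_mul_transpose_apply {n : ℕ} (G Y : Matrix (Fin n) (Fin n) ℂ) (i j : Fin n) :
    (G * Y * Gᵀ) i j = ∑ b, (∑ a, G i a * Y a b) * G j b := by
  simp [Matrix.mul_apply]

/-- The pfaffian of the pencil, as a polynomial identity in the entries of the coefficient
of `y`. -/
theorem IsPfaffianRep.pfaffianSix_pencil {l : ℂ} {A : LinearMatrix 6}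
    (hA : IsPfaffianRep (weierstrassCubic l) A) (h0 : A 0 = canonicalX) (h2 : A 2 = canonicalZ)
    (x y z : ℂ) : pfaffianSix (x • canonicalX + y • A 1 + z • canonicalZ) =
      -(y * z ^ 2 - x * (x - y) * (x - l * y)) := by
  have h := hA.pfaffianSix_eq h0 ![x, y, z]
  rw [eval_weierstrassCubic, Fin.sum_univ_three, h0, h2] at h
  simpa using h

theorem coeff_eq_zero_of_cubic {a b c d e f : ℂ}
    (h : ∀ x y z : ℂ, a * (x ^ 2 * y) + b * (x * y ^ 2) + c * y ^ 3 + d * (y ^ 2 * z) +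
      e * (x * y * z) + f * (y * z ^ 2) = 0) :
    a = 0 ∧ b = 0 ∧ c = 0 ∧ d = 0 ∧ e = 0 ∧ f = 0 := by
  have h1 := h 0 1 0
  have h2 := h 1 1 0
  have h3 := h (-1) 1 0
  have h4 := h 0 1 1
  have h5 := h 0 1 (-1)
  have h6 := h 1 1 1
  refine ⟨?_, ?_, ?_, ?_, ?_, ?_⟩
  · linear_combination (h2 + h3) / 2 - h1
  · linear_combination (h2 - h3) / 2
  · linear_combination h1
  · linear_combination (h4 - h5) / 2
  · linear_combination h6 - h2 - h4 + h1
  · linear_combination (h4 + h5) / 2 - h1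

/-- A shear removes the entries of the coefficient of `y` that pair the kernel of `canonicalZ`
with the next step of the Jordan chains. The kernel itself is spanned by the vectors of index `2`
and `5`, and the coefficient of `y z ^ 2` says that it is not isotropic. -/
theorem IsPfaffianRep.exists_shear {l : ℂ} {A : LinearMatrix 6}
    (hA : IsPfaffianRep (weierstrassCubic l) A) (h0 : A 0 = canonicalX) (h2 : A 2 = canonicalZ) :
    ∃ B : LinearMatrix 6, PfaffEquiv A B ∧ B 0 = canonicalX ∧ B 2 = canonicalZ ∧
      B 1 1 2 = 0 ∧ B 1 1 5 = 0 ∧ B 1 4 5 = 0 ∧ B 1 2 4 = 0 ∧ B 1 2 5 = -1 := by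
  have hpf := hA.pfaffianSix_pencil h0 h2
  have hskew := hA.apply_swap 1
  have hdiag := hA.apply_self 1
  generalize hY : A 1 = Y at hpf hskew hdiag
  simp only [pfaffianSix, canonicalX, canonicalZ, skewOfUpper, Matrix.add_apply,
    Matrix.smul_apply] at hpf
  simp at hpf
  obtain ⟨-, -, -, -, he, hf⟩ := coeff_eq_zero_of_cubic
    (a := Y 0 5 + Y 1 4 + Y 2 3 + (1 + l))
    (b := Y 0 5 * (Y 1 4 + Y 2 3) + Y 1 4 * Y 2 3 + Y 0 1 * Y 4 5 + Y 0 2 * Y 3 5 - Y 0 3 * Y 2 5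
      - Y 0 4 * Y 1 5 + Y 1 2 * Y 3 4 - Y 1 3 * Y 2 4 - l)
    (c := pfaffianSix Y)
    (d := Y 2 5 * (Y 0 4 + Y 1 3) - Y 0 2 * Y 4 5 - Y 1 2 * Y 3 5 - Y 0 5 * Y 2 4 - Y 1 5 * Y 2 3)
    (e := -(Y 1 5 + Y 2 4)) (f := Y 2 5 + 1)
    (fun x y z => by
      unfold pfaffianSix
      linear_combination hpf x y z)
  have h25 : Y 2 5 = -1 := by linear_combination hf
  have h24 : Y 2 4 = -Y 1 5 := by linear_combination -he
  have h52 : Y 5 2 = 1 := by rw [hskew 2 5, h25, neg_neg]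
  have hB := pfaffEquiv_of_toeplitzBlocks (p := Y 1 5) (q := -Y 1 2) (r := Y 4 5)
    (a := Y 1 5 ^ 2 - Y 1 2 * Y 4 5) (b := 0) (c := 0) (d := 0) h0 h2 (by ring)
  rw [hY] at hB
  refine ⟨_, hB, rfl, rfl, ?_, ?_, ?_, ?_, ?_⟩ <;>
  · refine (mul_mul_transpose_apply _ _ _ _).trans ?_
    simp only [Fin.sum_univ_succ]
    simp [toeplitzBlocks, hdiag, h25, h24, h52]

/-- A shear of second order makes the entries pairing the two ends of the Jordan chains scalar. -/
theorem IsPfaffianRep.exists_second_shear {l : ℂ} {A : LinearMatrix 6}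
    (hA : IsPfaffianRep (weierstrassCubic l) A) (h0 : A 0 = canonicalX) (h2 : A 2 = canonicalZ)
    (h12 : A 1 1 2 = 0) (h15 : A 1 1 5 = 0) (h45 : A 1 4 5 = 0) (h24 : A 1 2 4 = 0)
    (h25 : A 1 2 5 = -1) :
    ∃ B : LinearMatrix 6, PfaffEquiv A B ∧ B 0 = canonicalX ∧ B 2 = canonicalZ ∧
      (B 1 1 2 = 0 ∧ B 1 1 5 = 0 ∧ B 1 4 5 = 0 ∧ B 1 2 4 = 0 ∧ B 1 2 5 = -1) ∧
      B 1 0 2 = 0 ∧ B 1 3 5 = 0 ∧ B 1 0 5 = B 1 2 3 := by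
  have hskew := hA.apply_swap 1
  have hdiag := hA.apply_self 1
  have h52 : A 1 5 2 = 1 := by rw [hskew 2 5, h25, neg_neg]
  have hB := pfaffEquiv_of_toeplitzBlocks (p := 0) (q := 0) (r := 0)
    (a := (A 1 0 5 - A 1 2 3) / 2) (b := -A 1 0 2) (c := A 1 3 5) (d := -(A 1 0 5 - A 1 2 3) / 2)
    h0 h2 (by ring)
  refine ⟨_, hB, rfl, rfl, ⟨?_, ?_, ?_, ?_, ?_⟩, ?_, ?_, ?_⟩
  on_goal 8 =>
    refine (mul_mul_transpose_apply _ _ _ _).trans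
      (Eq.trans ?_ (mul_mul_transpose_apply _ _ _ _).symm)
  all_goals
    first
      | refine (mul_mul_transpose_apply _ _ _ _).trans ?_
      | skip
    simp only [Fin.sum_univ_succ]
    simp [toeplitzBlocks, hdiag, h25, h24, h52, h12, h15, h45]
  ring

theorem skewSymmetric_ext {n : ℕ} {M N : Matrix (Fin n) (Fin n) ℂ} (hM : Mᵀ = -M) (hN : Nᵀ = -N)
    (h : ∀ i j, i < j → M i j = N i j) : M = N := by
  have hM' (i j) : M j i = -M i j := congrFun (congrFun hM i) j
  have hN' (i j) : N j i = -N i j := congrFun (congrFun hN i) j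
  ext i j
  rcases lt_trichotomy i j with hij | rfl | hij
  · exact h i j hij
  · rw [self_eq_neg.1 (hM' i i), self_eq_neg.1 (hN' i i)]
  · rw [hM' j i, hN' j i, h j i hij]

/-- After the two shears, the coefficients of the pfaffian determine all entries but those of `K`
and one more, which is `-t`. -/
theorem IsPfaffianRep.eq_normalRep {l : ℂ} {A : LinearMatrix 6}
    (hA : IsPfaffianRep (weierstrassCubic l) A) (h0 : A 0 = canonicalX) (h2 : A 2 = canonicalZ)
    (h12 : A 1 1 2 = 0) (h15 : A 1 1 5 = 0) (h45 : A 1 4 5 = 0) (h24 : A 1 2 4 = 0)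
    (h25 : A 1 2 5 = -1) (h02 : A 1 0 2 = 0) (h35 : A 1 3 5 = 0) (h05 : A 1 0 5 = A 1 2 3) :
    ∃ t p q r : ℂ, p ^ 2 + q * r = t * (t - 1) * (t - l) ∧ A = normalRep l t p q r := by
  have hpf := hA.pfaffianSix_pencil h0 h2
  simp only [pfaffianSix, canonicalX, canonicalZ, skewOfUpper, Matrix.add_apply,
    Matrix.smul_apply] at hpf
  simp [h12, h15, h45, h24, h25, h02, h35, h05] at hpf
  obtain ⟨ha, hb, hc, hd, -, -⟩ := coeff_eq_zero_of_cubic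
    (a := 2 * A 1 2 3 + A 1 1 4 + (1 + l))
    (b := A 1 2 3 ^ 2 + 2 * A 1 2 3 * A 1 1 4 + A 1 0 3 - l)
    (c := A 1 2 3 ^ 2 * A 1 1 4 + A 1 0 3 * A 1 1 4
      - A 1 0 4 * A 1 1 3 - A 1 0 1 * A 1 3 4)
    (d := -(A 1 0 4 + A 1 1 3)) (e := 0) (f := 0)
    (fun x y z => by
      linear_combination hpf x y z)
  have h23 : A 1 2 3 = (-A 1 1 4 - 1 - l) / 2 := by linear_combination ha / 2
  have h13 : A 1 1 3 = -A 1 0 4 := by linear_combination -hd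
  have h03 : A 1 0 3 = (3 * (-A 1 1 4) ^ 2 - 2 * (-A 1 1 4) * (1 + l) - (1 - l) ^ 2) / 4 := by
    rw [h23] at hb
    linear_combination hb
  refine ⟨-A 1 1 4, A 1 0 4, -A 1 0 1, A 1 3 4, ?_, ?_⟩
  · rw [h23, h13, h03] at hc
    linear_combination hc
  · funext k
    fin_cases k
    · exact h0
    · refine skewSymmetric_ext (hA.1 1) (skewOfUpper_transpose _) fun i j hij => ?_
      fin_cases i <;> fin_cases j <;>
        simp [normalRep, skewOfUpper, h12, h15, h45, h24, h25, h02, h35, h05, h03, h13, h23]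
          at hij ⊢
    · exact h2

/-- A representation whose coefficients of `x` and `z` are the canonical ones is equivalent to
a normal form. -/
theorem IsPfaffianRep.exists_pfaffEquiv_normalRep {l : ℂ} {A : LinearMatrix 6}
    (hA : IsPfaffianRep (weierstrassCubic l) A) (h0 : A 0 = canonicalX) (h2 : A 2 = canonicalZ) :
    ∃ t p q r : ℂ, p ^ 2 + q * r = t * (t - 1) * (t - l) ∧ PfaffEquiv A (normalRep l t p q r) := by
  obtain ⟨B, hAB, hB0, hB2, h12, h15, h45, h24, h25⟩ := hA.exists_shear h0 h2
  have hB := hAB.isPfaffianRep hA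
  obtain ⟨D, hBD, hD0, hD2, ⟨h12, h15, h45, h24, h25⟩, h02, h35, h05⟩ :=
    hB.exists_second_shear hB0 hB2 h12 h15 h45 h24 h25
  obtain ⟨t, p, q, r, ht, rfl⟩ :=
    (hBD.isPfaffianRep hB).eq_normalRep hD0 hD2 h12 h15 h45 h24 h25 h02 h35 h05
  exact ⟨t, p, q, r, ht, hAB.trans hBD⟩

/-! ### The pencil spanned by the coefficients of `x` and `z` -/

section Chains

variable {n : ℕ} {J N : Matrix (Fin n) (Fin n) ℂ}

theorem transpose_pow_mul_eq (hJN : Nᵀ * J = J * N) (k : ℕ) : (N ^ k)ᵀ * J = J * N ^ k := by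
  induction k with
  | zero => simp
  | succ k ih =>
    rw [pow_succ, Matrix.transpose_mul, Matrix.mul_assoc, ih, ← Matrix.mul_assoc, hJN,
      Matrix.mul_assoc, ← pow_succ', pow_succ]

theorem transpose_mul_pow (hJ : Jᵀ = -J) (hJN : Nᵀ * J = J * N) (k : ℕ) :
    (J * N ^ k)ᵀ = -(J * N ^ k) := by
  rw [Matrix.transpose_mul, hJ, Matrix.mul_neg, transpose_pow_mul_eq hJN]

theorem dotProduct_mulVec_swap {M : Matrix (Fin n) (Fin n) ℂ} (hM : Mᵀ = -M) (u v : Fin n → ℂ) :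
    v ⬝ᵥ (M *ᵥ u) = -(u ⬝ᵥ (M *ᵥ v)) := by
  rw [Matrix.dotProduct_mulVec, ← Matrix.mulVec_transpose, hM, Matrix.neg_mulVec,
    neg_dotProduct, dotProduct_comm]

theorem dotProduct_mulVec_self {M : Matrix (Fin n) (Fin n) ℂ} (hM : Mᵀ = -M) (u : Fin n → ℂ) :
    u ⬝ᵥ (M *ᵥ u) = 0 :=
  self_eq_neg.1 (dotProduct_mulVec_swap hM u u)

theorem pow_mulVec_dotProduct (hJN : Nᵀ * J = J * N) (i j k : ℕ) (u v : Fin n → ℂ) :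
    (N ^ i *ᵥ u) ⬝ᵥ ((J * N ^ k) *ᵥ (N ^ j *ᵥ v)) = u ⬝ᵥ ((J * N ^ (i + j + k)) *ᵥ v) := by
  rw [dotProduct_comm, Matrix.dotProduct_mulVec, ← Matrix.mulVec_transpose, dotProduct_comm,
    Matrix.mulVec_mulVec, Matrix.mulVec_mulVec, ← Matrix.mul_assoc, transpose_pow_mul_eq hJN]
  simp only [Matrix.mul_assoc, ← pow_add]
  rw [Nat.add_right_comm i k j]

/-- The Jordan chain of a vector under `N` is isotropic for `J`, hence has length at most half the
dimension. -/
theorem pow_three_eq_zero {J N : Matrix (Fin 6) (Fin 6) ℂ} (hJ : Jᵀ = -J)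
    (hJN : Nᵀ * J = J * N) (hJu : IsUnit J.det) (hN : N ^ 6 = 0) : N ^ 3 = 0 := by
  have step (u : Fin 6 → ℂ) (h4 : N ^ 4 *ᵥ u = 0) : N ^ 3 *ᵥ u = 0 := by
    by_contra h3
    let T : Matrix (Fin 4) (Fin 6) ℂ := fun i => N ^ (i : ℕ) *ᵥ u
    have hli : LinearIndependent ℂ T.row := by
      rw [Fintype.linearIndependent_iff]
      intro g hg
      have hg : g 0 • u + g 1 • (N *ᵥ u) + g 2 • (N ^ 2 *ᵥ u) + g 3 • (N ^ 3 *ᵥ u) = 0 := by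
        rw [← hg, Fin.sum_univ_four]
        simp [T, Matrix.row]
      have app (k : ℕ) : g 0 • (N ^ k *ᵥ u) + g 1 • (N ^ (k + 1) *ᵥ u) +
          g 2 • (N ^ (k + 2) *ᵥ u) + g 3 • (N ^ (k + 3) *ᵥ u) = 0 := by
        have := congrArg (N ^ k *ᵥ ·) hg
        simpa [Matrix.mulVec_add, Matrix.mulVec_smul, Matrix.mulVec_mulVec, ← pow_add,
          ← pow_succ] using this
      have hz (k : ℕ) : N ^ (k + 4) *ᵥ u = 0 := by
        rw [pow_add, ← Matrix.mulVec_mulVec, h4, Matrix.mulVec_zero]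
      have g0 : g 0 = 0 := by
        have := app 3
        simpa [hz 0, hz 1, hz 2, h3] using this
      have g1 : g 1 = 0 := by
        have := app 2
        simpa [g0, hz 0, hz 1, h3] using this
      have g2 : g 2 = 0 := by
        have := app 1
        simpa [g0, g1, hz 0, h3] using this
      have g3 : g 3 = 0 := by
        have := app 0
        simpa [g0, g1, g2, h3] using this
      intro i
      fin_cases i <;> assumption
    have hiso : T * (J * Tᵀ) = 0 := by
      ext i j
      have h1 : (T * (J * Tᵀ)) i j = T i ⬝ᵥ (J *ᵥ T j) := rfl
      have h2 := pow_mulVec_dotProduct hJN i j 0 u u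
      rw [pow_zero, Matrix.mul_one] at h2
      rw [h1, Matrix.zero_apply]
      exact h2.trans (dotProduct_mulVec_self (transpose_mul_pow hJ hJN _) u)
    have hr := Matrix.rank_add_rank_le_card_of_mul_eq_zero hiso
    rw [Matrix.rank_mul_eq_right_of_isUnit_det _ _ hJu, Matrix.rank_transpose,
      hli.rank_matrix] at hr
    norm_num at hr
  have step' (k : ℕ) (h : N ^ (k + 4) = 0) : N ^ (k + 3) = 0 := by
    refine Matrix.ext_of_mulVec_single fun i => ?_
    rw [add_comm, pow_add, ← Matrix.mulVec_mulVec, Matrix.zero_mulVec]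
    apply step
    rw [Matrix.mulVec_mulVec, ← pow_add, add_comm, h, Matrix.zero_mulVec]
  exact step' 0 (step' 1 (step' 2 hN))

/-- Two Jordan chains of length three that are dual to each other for `J`. -/
theorem exists_dual_chains {J N : Matrix (Fin 6) (Fin 6) ℂ} (hJ : Jᵀ = -J)
    (hJN : Nᵀ * J = J * N) (hJu : IsUnit J) (hN2 : N ^ 2 ≠ 0) (hN3 : N ^ 3 = 0) :
    ∃ P : Matrix (Fin 6) (Fin 6) ℂ,
      P * J * Pᵀ = canonicalX ∧ P * (J * N) * Pᵀ = canonicalZ := by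
  obtain ⟨u, v, h2⟩ : ∃ u v : Fin 6 → ℂ, u ⬝ᵥ ((J * N ^ 2) *ᵥ v) = 1 := by
    have hne : J * N ^ 2 ≠ 0 := fun h => hN2 (hJu.mul_right_eq_zero.1 h)
    obtain ⟨i, j, hij⟩ : ∃ i j, (J * N ^ 2) i j ≠ 0 := by
      by_contra! h
      exact hne (Matrix.ext h)
    refine ⟨Pi.single i 1, Pi.single j ((J * N ^ 2) i j)⁻¹, ?_⟩
    simp [hij]
  set b := u ⬝ᵥ ((J * N ^ 1) *ᵥ v) with hb
  set a := u ⬝ᵥ ((J * N ^ 0) *ᵥ v) with ha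
  -- Multiply `v` by the polynomial in `N` that makes its chain dual to that of `u`.
  set w := v - b • (N ^ 1 *ᵥ v) + (b ^ 2 - a) • (N ^ 2 *ᵥ v) with hw
  have hz (k : ℕ) (x y : Fin 6 → ℂ) : x ⬝ᵥ ((J * N ^ (k + 3)) *ᵥ y) = 0 := by
    rw [pow_add, hN3]
    simp
  have hval (k : ℕ) : u ⬝ᵥ ((J * N ^ k) *ᵥ w) = u ⬝ᵥ ((J * N ^ k) *ᵥ v) -
      b * (u ⬝ᵥ ((J * N ^ (k + 1)) *ᵥ v)) + (b ^ 2 - a) * (u ⬝ᵥ ((J * N ^ (k + 2)) *ᵥ v)) := by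
    rw [hw]
    simp only [Matrix.mulVec_add, Matrix.mulVec_sub, Matrix.mulVec_smul, Matrix.mulVec_mulVec,
      dotProduct_add, dotProduct_sub, dotProduct_smul, smul_eq_mul, Matrix.mul_assoc, ← pow_add]
  have w0 : u ⬝ᵥ ((J * N ^ 0) *ᵥ w) = 0 := by
    rw [hval, zero_add, zero_add, h2, ← hb, ← ha]
    ring
  have w1 : u ⬝ᵥ ((J * N ^ 1) *ᵥ w) = 0 := by
    rw [hval, h2, hz 0, ← hb]
    ring
  have w2 : u ⬝ᵥ ((J * N ^ 2) *ᵥ w) = 1 := by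
    rw [hval, h2, hz 0, hz 1]
    ring
  have hdual (k : ℕ) : u ⬝ᵥ ((J * N ^ k) *ᵥ w) = if k = 2 then 1 else 0 := by
    match k with
    | 0 => simpa using w0
    | 1 => simpa using w1
    | 2 => simpa using w2
    | k + 3 => rw [hz, if_neg (by omega)]
  have hdual' (k : ℕ) : w ⬝ᵥ ((J * N ^ k) *ᵥ u) = if k = 2 then -1 else 0 := by
    rw [dotProduct_mulVec_swap (transpose_mul_pow hJ hJN k), hdual]
    split_ifs <;> simp
  have hself (k : ℕ) (x : Fin 6 → ℂ) : x ⬝ᵥ ((J * N ^ k) *ᵥ x) = 0 :=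
    dotProduct_mulVec_self (transpose_mul_pow hJ hJN k) x
  let P : Matrix (Fin 6) (Fin 6) ℂ :=
    ![N ^ 0 *ᵥ u, N ^ 1 *ᵥ u, N ^ 2 *ᵥ u, N ^ 0 *ᵥ w, N ^ 1 *ᵥ w, N ^ 2 *ᵥ w]
  have hentry (k : ℕ) (i j : Fin 6) :
      (P * (J * N ^ k) * Pᵀ) i j = P i ⬝ᵥ ((J * N ^ k) *ᵥ P j) := by
    rw [Matrix.mul_assoc]
    rfl
  -- Naming the forms prevents the rewriting of `N ^ 0` and `N ^ 1`.
  obtain ⟨Ω, hΩ⟩ : ∃ Ω : ℕ → (Fin 6 → ℂ) → (Fin 6 → ℂ) → ℂ,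
      ∀ k x y, x ⬝ᵥ ((J * N ^ k) *ᵥ y) = Ω k x y := ⟨_, fun _ _ _ => rfl⟩
  simp only [hΩ] at hself hdual hdual'
  refine ⟨P, ?_, ?_⟩
  · have h (i j) := hentry 0 i j
    rw [pow_zero, Matrix.mul_one] at h
    ext i j
    rw [h, ← Matrix.mul_one J, ← pow_zero N]
    fin_cases i <;> fin_cases j <;>
    · refine (pow_mulVec_dotProduct hJN _ _ _ _ _).trans ?_
      rw [hΩ]
      simp [hself, hdual, hdual', canonicalX, skewOfUpper]
  · have h (i j) := hentry 1 i j
    rw [pow_one] at h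
    ext i j
    rw [h]
    conv_lhs => rw [← pow_one N]
    fin_cases i <;> fin_cases j <;>
    · refine (pow_mulVec_dotProduct hJN _ _ _ _ _).trans ?_
      rw [hΩ]
      simp [hself, hdual, hdual', canonicalZ, skewOfUpper]

end Chains

/-- At the flex `(0 : 0 : 1)` the cubic is smooth, so the determinant vanishes there to order two
only. If `N` squared to zero it would vanish to order three. -/
theorem sq_ne_zero_of_det {N M : Matrix (Fin 6) (Fin 6) ℂ}
    (h : ∀ y : ℂ, (N + y • M).det = y ^ 2) : N ^ 2 ≠ 0 := by
  intro hN
  have hsq (y : ℂ) : (N + y • M) * (N + y • M) = y • (N * M + M * N + y • (M * M)) := by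
    rw [Matrix.add_mul, Matrix.mul_add, Matrix.mul_add, ← pow_two, hN]
    simp only [Matrix.mul_smul, Matrix.smul_mul, smul_add, zero_add, add_assoc]
  have hdet (y : ℂ) : y ^ 4 = y ^ 6 * (N * M + M * N + y • (M * M)).det := by
    have := congrArg Matrix.det (hsq y)
    rw [Matrix.det_mul, h, Matrix.det_smul, Fintype.card_fin] at this
    rw [← this]
    ring
  have hcont : Continuous fun y : ℂ => y ^ 2 * (N * M + M * N + y • (M * M)).det := by
    refine (continuous_pow 2).mul (Continuous.matrix_det ?_)
    fun_prop
  have heq : (fun y : ℂ => y ^ 2 * (N * M + M * N + y • (M * M)).det) = fun _ => 1 := by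
    refine hcont.ext_on (dense_compl_singleton (0 : ℂ)) continuous_const fun y hy => ?_
    have hy : y ^ 4 ≠ 0 := pow_ne_zero _ hy
    refine mul_left_cancel₀ hy ?_
    rw [mul_one]
    conv_rhs => rw [hdet y]
    ring
  simpa using congrFun heq 0

theorem pow_six_eq_zero_of_det {N : Matrix (Fin 6) (Fin 6) ℂ}
    (h : ∀ x : ℂ, (x • (1 : Matrix (Fin 6) (Fin 6) ℂ) - N).det = x ^ 6) : N ^ 6 = 0 := by
  have hchar : N.charpoly = Polynomial.X ^ 6 := by
    refine Polynomial.funext fun x => ?_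
    rw [Matrix.eval_charpoly, Matrix.scalar_apply, ← Matrix.smul_one_eq_diagonal, h]
    simp
  simpa [hchar] using Matrix.aeval_self_charpoly N

/-- The canonical form of the pencil cut out on the line `y = 0`. -/
theorem IsPfaffianRep.exists_pfaffEquiv_canonicalX_canonicalZ {l : ℂ} {A : LinearMatrix 6}
    (hA : IsPfaffianRep (weierstrassCubic l) A) :
    ∃ B : LinearMatrix 6, PfaffEquiv A B ∧ B 0 = canonicalX ∧ B 2 = canonicalZ := by
  obtain ⟨c, hc, hdet⟩ := (isDeterminantalRep_iff _ _ _).1 hA.2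
  have hdet (x y z : ℂ) : (x • A 0 + y • A 1 + z • A 2).det =
      c * (y * z ^ 2 - x * (x - y) * (x - l * y)) ^ 2 := by
    have := hdet ![x, y, z]
    rw [Fin.sum_univ_three, eval_weierstrassCubic] at this
    simpa using this
  have hdet0 : (A 0).det = c := by
    have := hdet 1 0 0
    simpa using this
  have hJu : IsUnit (A 0).det := by rw [hdet0]; exact hc.isUnit
  set N := (A 0)⁻¹ * A 2 with hN
  set M := (A 0)⁻¹ * A 1 with hM
  have hJN : A 0 * N = A 2 := by rw [hN, Matrix.mul_nonsing_inv_cancel_left _ _ hJu]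
  have hJM : A 0 * M = A 1 := by rw [hM, Matrix.mul_nonsing_inv_cancel_left _ _ hJu]
  have hadj : Nᵀ * A 0 = A 0 * N := by
    have h := congrArg Matrix.transpose hJN
    rw [Matrix.transpose_mul, hA.1 0, hA.1 2, Matrix.mul_neg] at h
    rw [neg_injective h, hJN]
  have hN6 : N ^ 6 = 0 := by
    refine pow_six_eq_zero_of_det fun x => mul_left_cancel₀ hc ?_
    rw [← hdet0, ← Matrix.det_mul, Matrix.mul_sub, Matrix.mul_smul, Matrix.mul_one, hJN, hdet0]
    have := hdet x 0 (-1)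
    rw [zero_smul, add_zero, neg_one_smul, ← sub_eq_add_neg] at this
    rw [this]
    ring
  have hN2 : N ^ 2 ≠ 0 := by
    refine sq_ne_zero_of_det (M := M) fun y => mul_left_cancel₀ hc ?_
    rw [← hdet0, ← Matrix.det_mul, Matrix.mul_add, Matrix.mul_smul, hJN, hJM, hdet0]
    have := hdet 0 y 1
    rw [zero_smul, zero_add, one_smul, add_comm] at this
    rw [this]
    ring
  obtain ⟨P, hX, hZ⟩ := exists_dual_chains (hA.1 0) hadj
    ((Matrix.isUnit_iff_isUnit_det _).2 hJu) hN2 (pow_three_eq_zero (hA.1 0) hadj hJu hN6)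
  rw [hJN] at hZ
  exact ⟨fun k => P * A k * Pᵀ, ⟨(isUnit_of_mul_mul_transpose_eq_canonicalX hX).unit,
    fun k => rfl⟩, hX, hZ⟩

end LinearMatrix

end

/-! ### The classification -/

theorem theorem3p1 (l : ℂ) (hF : IsSmoothCurve (weierstrassCubic l)) :
    -- every affine point of the cubic gives a decomposable pfaffian representation
    (∀ t s : ℂ, s ^ 2 = t * (t - 1) * (t - l) →
      LinearMatrix.IsPfaffianRep (weierstrassCubic l) (decomposableRep l t s) ∧
      LinearMatrix.IsDecomposablePfaffian (weierstrassCubic l) (decomposableRep l t s)) ∧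
    -- each of `t = 0, 1, l` gives an indecomposable pfaffian representation
    (∀ t ∈ ({0, 1, l} : Set ℂ),
      LinearMatrix.IsPfaffianRep (weierstrassCubic l) (indecomposableRep l t) ∧
      ¬ LinearMatrix.IsDecomposablePfaffian (weierstrassCubic l) (indecomposableRep l t) ∧
      LinearMatrix.IsIndecomposable (indecomposableRep l t)) ∧
    -- the list is complete
    (∀ A : LinearMatrix 6, LinearMatrix.IsPfaffianRep (weierstrassCubic l) A →
      (LinearMatrix.IsDecomposablePfaffian (weierstrassCubic l) A ∧
        ∃ t s : ℂ, s ^ 2 = t * (t - 1) * (t - l) ∧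
          LinearMatrix.PfaffEquiv A (decomposableRep l t s)) ∨
      (¬ LinearMatrix.IsDecomposablePfaffian (weierstrassCubic l) A ∧
        ∃! t : ℂ, t ∈ ({0, 1, l} : Set ℂ) ∧
          LinearMatrix.PfaffEquiv A (indecomposableRep l t))) ∧
    -- there are exactly three equivalence classes of indecomposable ones
    (({0, 1, l} : Set ℂ).ncard = 3 ∧
      ∀ t ∈ ({0, 1, l} : Set ℂ), ∀ t' ∈ ({0, 1, l} : Set ℂ),
        LinearMatrix.PfaffEquiv (indecomposableRep l t) (indecomposableRep l t') → t = t') ∧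
    -- points of the cubic give equivalent representations iff they agree up to the sign of `s`
    (∀ t s t' s' : ℂ, s ^ 2 = t * (t - 1) * (t - l) → s' ^ 2 = t' * (t' - 1) * (t' - l) →
      (LinearMatrix.PfaffEquiv (decomposableRep l t s) (decomposableRep l t' s') ↔
        t = t' ∧ (s = s' ∨ s = -s'))) := by
  have hnot (t : ℂ) :
      ¬ LinearMatrix.IsDecomposablePfaffian (weierstrassCubic l) (indecomposableRep l t) :=
    fun h => h.not_isIndecomposable (LinearMatrix.isIndecomposable_indecomposableRep l t)
  refine ⟨fun t s h => ⟨?_, LinearMatrix.isDecomposablePfaffian_decomposableRep h⟩,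
    fun t ht => ⟨?_, hnot t, LinearMatrix.isIndecomposable_indecomposableRep l t⟩,
    fun A hA => ?_, ⟨?_, fun t _ t' _ h => LinearMatrix.eq_of_pfaffEquiv_indecomposableRep h⟩,
    fun t s t' s' _ _ => LinearMatrix.pfaffEquiv_decomposableRep_iff⟩
  · rw [LinearMatrix.decomposableRep_eq_normalRep]
    exact LinearMatrix.isPfaffianRep_normalRep (by rw [← h]; ring)
  · rw [LinearMatrix.indecomposableRep_eq_normalRep]
    refine LinearMatrix.isPfaffianRep_normalRep ?_
    rcases ht with rfl | rfl | rfl <;> ring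
  · obtain ⟨B, hAB, hB0, hB2⟩ := hA.exists_pfaffEquiv_canonicalX_canonicalZ
    obtain ⟨t, p, q, r, ht, hB⟩ := (hAB.isPfaffianRep hA).exists_pfaffEquiv_normalRep hB0 hB2
    have hA' := hAB.trans hB
    rcases LinearMatrix.normalRep_pfaffEquiv_canonical ht with ⟨s, hs, h⟩ | ⟨ht, h⟩
    · have h := hA'.trans h
      exact Or.inl ⟨h.isDecomposablePfaffian_iff.2
        (LinearMatrix.isDecomposablePfaffian_decomposableRep hs), t, s, hs, h⟩
    · have h := hA'.trans h
      exact Or.inr ⟨fun hd => hnot t (h.isDecomposablePfaffian_iff.1 hd), t, ⟨ht, h⟩,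
        fun t' ht' => LinearMatrix.eq_of_pfaffEquiv_indecomposableRep (ht'.2.symm.trans h)⟩
  · obtain ⟨h0, h1⟩ := LinearMatrix.ne_of_isSmoothCurve hF
    exact Set.ncard_eq_three.2 ⟨0, 1, l, zero_ne_one, h0.symm, h1.symm, rfl⟩
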